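/- Let $n\ge 1$ and let $S^{n-1}$ be the unit sphere of $\mathbb{R}^n$. Let $C^\infty(S^{n-1})$ be the Fréchet space of real-valued smooth functions (test functions) on $S^{n-1}$, with the topology of uniform convergence of all derivatives, and let $\mathcal{D}(S^{n-1})$ be its topological dual, the space of distributions on $S^{n-1}$. For $u\in S^{n-1}$ let $O(u)$ be the compact group of all orthogonal transformations of $\mathbb{R}^n$ that fix $u$, with normalized Haar measure $m$. For $f\in C^\infty(S^{n-1})$ put $$(S_uf)(x)=\int_{O(u)}f(Tx)\,dm(T),\qquad x\in S^{n-1};$$ this is again a test function, and for $\rho\in\mathcal{D}(S^{n-1})$ the distribution $S_u\rho$ is defined by $\langle S_u\rho,f\rangle=\langle\rho,S_uf\rangle$ for all $f\in C^\infty(S^{n-1})$. A distribution $\rho$ is called positive if $\langle\rho,f\rangle\ge 0$ for every test function $f\ge 0$. Then a distribution $\rho\in\mathcal{D}(S^{n-1})$ is positive if and only if $S_u\rho$ is positive for every $u\in S^{n-1}$. -/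

import Mathlib

open MeasureTheory Metric
open scoped Manifold ContDiff

noncomputable section

namespace SphereSpin

/-- Euclidean space `ℝ^(d+1)`. -/
abbrev Euc (d : ℕ) : Type := EuclideanSpace ℝ (Fin (d + 1))

/-- The unit sphere `S^d` of `ℝ^(d+1)`. -/
abbrev Sph (d : ℕ) : Type := sphere (0 : Euc d) 1

/-- Test functions: the real-valued `C^∞` functions on the manifold `S^d`. -/
abbrev TestFun (d : ℕ) : Type := C^∞⟮𝓡 d, Sph d; 𝓘(ℝ, ℝ), ℝ⟯

variable {d : ℕ}

/-! ### The Fréchet topology of `C^∞(S^d)` -/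

/-- The extension of a function on the sphere to `ℝ^(d+1) \ {0}` that is homogeneous of degree `0`,
`x ↦ f (x / ‖x‖)` (with the irrelevant value `0` at the origin). -/
def homExt (f : Sph d → ℝ) (x : Euc d) : ℝ :=
  if h : x = 0 then 0 else f ⟨‖x‖⁻¹ • x, by simp [norm_smul, h]⟩

lemma homExt_coe (f : Sph d → ℝ) (x : Sph d) : homExt f x = f x := by
  have hx : ‖(x : Euc d)‖ = 1 := by simp
  have h0 : (x : Euc d) ≠ 0 := by
    intro h; simp [h] at hx
  simp [homExt, h0]

lemma homExt_add (f g : Sph d → ℝ) : homExt (f + g) = homExt f + homExt g := by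
  ext x
  by_cases h : x = 0 <;> simp [homExt, h]

lemma homExt_smul (c : ℝ) (f : Sph d → ℝ) : homExt (c • f) = c • homExt f := by
  ext x
  by_cases h : x = 0 <;> simp [homExt, h]

/-- The degree `0` extension of a smooth function is smooth away from the origin. -/
lemma contDiffOn_homExt (f : TestFun d) : ContDiffOn ℝ ∞ (homExt f) {0}ᶜ := by
  let U : TopologicalSpace.Opens (Euc d) := ⟨{0}ᶜ, isOpen_compl_singleton⟩
  have hn : ContDiffOn ℝ ∞ (fun x : Euc d => ‖x‖⁻¹ • x) {0}ᶜ := by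
    intro x hx
    have hx' : x ≠ 0 := hx
    exact (((contDiffAt_norm ℝ hx').inv (norm_ne_zero_iff.2 hx')).smul
      contDiffAt_id).contDiffWithinAt
  have h1 : ContMDiff 𝓘(ℝ, Euc d) 𝓘(ℝ, Euc d) ∞ (fun x : U => ‖(x : Euc d)‖⁻¹ • (x : Euc d)) := by
    intro x
    exact ((hn.contDiffAt (isOpen_compl_singleton.mem_nhds x.2)).contMDiffAt).comp x
      (contMDiff_subtype_val (n := ∞) x)
  have hmem : ∀ x : U, ‖(x : Euc d)‖⁻¹ • (x : Euc d) ∈ sphere (0 : Euc d) 1 := by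
    intro x
    have : (x : Euc d) ≠ 0 := x.2
    simp [norm_smul, this]
  have : Fact (Module.finrank ℝ (Euc d) = d + 1) := ⟨finrank_euclideanSpace_fin⟩
  have h2 := f.contMDiff.comp (ContMDiff.codRestrict_sphere (n := d) h1 hmem)
  intro x hx
  have hx' : x ≠ 0 := hx
  have h3 : ContMDiffAt 𝓘(ℝ, Euc d) 𝓘(ℝ, ℝ) ∞ (fun y : U => homExt f y) ⟨x, hx⟩ := by
    refine (h2 ⟨x, hx⟩).congr_of_eventuallyEq (Filter.Eventually.of_forall fun y => ?_)
    have : (y : Euc d) ≠ 0 := y.2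
    simp [homExt, this]
    rfl
  have h4 := (contMDiffAt_subtype_iff (U := U) (f := homExt f) (x := ⟨x, hx⟩)).1 h3
  exact h4.contDiffAt.contDiffWithinAt

lemma continuousOn_iteratedFDeriv_homExt (f : TestFun d) (k : ℕ) :
    ContinuousOn (iteratedFDeriv ℝ k (homExt f)) {0}ᶜ := by
  have h := (contDiffOn_homExt f).continuousOn_iteratedFDerivWithin (m := k)
    (mod_cast le_top) isOpen_compl_singleton.uniqueDiffOn
  exact h.congr fun x hx => (iteratedFDerivWithin_of_isOpen k isOpen_compl_singleton hx).symm

lemma sph_ne_zero (x : Sph d) : (x : Euc d) ∈ ({0}ᶜ : Set (Euc d)) := by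
  intro h
  have hx : ‖(x : Euc d)‖ = 1 := by simp
  rw [Set.mem_singleton_iff] at h
  simp [h] at hx

lemma bddAbove_iteratedFDeriv (f : TestFun d) (k : ℕ) :
    BddAbove (Set.range fun x : Sph d => ‖iteratedFDeriv ℝ k (homExt f) x‖) := by
  have h : Continuous fun x : Sph d => ‖iteratedFDeriv ℝ k (homExt f) x‖ :=
    ((continuousOn_iteratedFDeriv_homExt f k).comp_continuous continuous_subtype_val
      sph_ne_zero).norm
  simpa using (isCompact_range h).bddAbove

lemma contDiffAt_homExt (f : TestFun d) (x : Sph d) (k : ℕ) : ContDiffAt ℝ k (homExt f) x :=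
  ((contDiffOn_homExt f).contDiffAt (isOpen_compl_singleton.mem_nhds (sph_ne_zero x))).of_le
    (mod_cast le_top)

/-- The `k`-th `C^∞`-seminorm on test functions: the supremum over the sphere of the norm of the
`k`-th derivative of the degree `0` extension. -/
def testSeminorm (d k : ℕ) : Seminorm ℝ (TestFun d) :=
  Seminorm.of (fun f => ⨆ x : Sph d, ‖iteratedFDeriv ℝ k (homExt f) x‖)
    (by
      intro f g
      have : Nonempty (Sph d) := (NormedSpace.sphere_nonempty.2 zero_le_one).to_subtype
      refine ciSup_le fun x => ?_
      have : iteratedFDeriv ℝ k (homExt (f + g : TestFun d)) x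
          = iteratedFDeriv ℝ k (homExt f) x + iteratedFDeriv ℝ k (homExt g) x := by
        rw [ContMDiffMap.coe_add, homExt_add]
        exact iteratedFDeriv_add_apply (contDiffAt_homExt f x k) (contDiffAt_homExt g x k)
      rw [this]
      exact (norm_add_le _ _).trans (add_le_add (le_ciSup (bddAbove_iteratedFDeriv f k) x)
        (le_ciSup (bddAbove_iteratedFDeriv g k) x)))
    (by
      intro c f
      rw [Real.mul_iSup_of_nonneg (norm_nonneg c)]
      congr 1
      ext x
      rw [ContMDiffMap.coe_smul, homExt_smul,
        iteratedFDeriv_const_smul_apply (contDiffAt_homExt f x k), norm_smul])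

/-- The Fréchet topology of `C^∞(S^d)`: uniform convergence of all derivatives. -/
instance instTopologicalSpaceTestFun (d : ℕ) : TopologicalSpace (TestFun d) :=
  SeminormFamily.moduleFilterBasis (𝕜 := ℝ) (testSeminorm d) |>.topology

lemma testFun_withSeminorms (d : ℕ) :
    WithSeminorms (testSeminorm d : SeminormFamily ℝ (TestFun d) ℕ) := ⟨rfl⟩

/-- Distributions on `S^d`: the continuous linear functionals on test functions. -/
abbrev SphDistribution (d : ℕ) : Type := TestFun d →L[ℝ] ℝ

/-- A distribution is positive if it is nonnegative on every nonnegative test function. -/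
def IsPositive (ρ : SphDistribution d) : Prop := ∀ f : TestFun d, (∀ x, 0 ≤ f x) → 0 ≤ ρ f

/-! ### Averaging over the orthogonal transformations that fix `u` -/

instance instContinuousStarEuc (d : ℕ) : ContinuousStar (Euc d →L[ℝ] Euc d) :=
  ⟨(ContinuousLinearMap.adjoint (𝕜 := ℝ) (E := Euc d) (F := Euc d)).continuous⟩

/-- The orthogonal group of `ℝ^(d+1)`, with the topology of operators. -/
abbrev Orth (d : ℕ) : Type := unitary (Euc d →L[ℝ] Euc d)

/-- The group `O(u)` of the orthogonal transformations that fix `u`. -/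
def fixer (u : Sph d) : Subgroup (Orth d) where
  carrier := {T | (T : Euc d →L[ℝ] Euc d) u = u}
  one_mem' := by simp
  mul_mem' := by
    intro S T hS hT
    simp only [Set.mem_ofPred_eq] at hS hT ⊢
    simp [hT, hS]
  inv_mem' := by
    intro T hT
    simp only [Set.mem_ofPred_eq] at hT ⊢
    have h : ((T⁻¹ * T : Orth d) : Euc d →L[ℝ] Euc d) u = u := by
      rw [inv_mul_cancel]; rfl
    change ((T⁻¹ : Orth d) : Euc d →L[ℝ] Euc d) ((T : Euc d →L[ℝ] Euc d) u) = u at h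
    rwa [hT] at h

lemma norm_orth (T : Orth d) (x : Euc d) : ‖(T : Euc d →L[ℝ] Euc d) x‖ = ‖x‖ :=
  (Unitary.linearIsometryEquiv T).norm_map x

/-- The action of an orthogonal transformation on the sphere. -/
def rot (T : Orth d) (x : Sph d) : Sph d :=
  ⟨(T : Euc d →L[ℝ] Euc d) x, by rw [mem_sphere_zero_iff_norm, norm_orth]; simp⟩

instance instCompactSpaceFixer (u : Sph d) : CompactSpace (fixer u) := by
  have hemb : Topology.IsClosedEmbedding
      (fun T : fixer u => ((T : Orth d) : Euc d →L[ℝ] Euc d)) := by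
    refine ⟨Topology.IsEmbedding.subtypeVal.comp Topology.IsEmbedding.subtypeVal, ?_⟩
    have : Set.range (fun T : fixer u => ((T : Orth d) : Euc d →L[ℝ] Euc d))
        = (unitary (Euc d →L[ℝ] Euc d) : Set _) ∩ {A : Euc d →L[ℝ] Euc d | A (u : Euc d) = u} := by
      ext A
      constructor
      · rintro ⟨T, rfl⟩
        exact ⟨T.1.2, T.2⟩
      · rintro ⟨h1, h2⟩
        exact ⟨⟨⟨A, h1⟩, h2⟩, rfl⟩
    rw [this]
    exact isClosed_unitary.inter (isClosed_eq (by fun_prop) continuous_const)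
  have hb : Bornology.IsBounded
      (Set.range (fun T : fixer u => ((T : Orth d) : Euc d →L[ℝ] Euc d))) := by
    refine isBounded_iff_forall_norm_le.2 ⟨1, ?_⟩
    rintro _ ⟨T, rfl⟩
    refine ContinuousLinearMap.opNorm_le_bound _ zero_le_one fun x => ?_
    rw [one_mul, norm_orth]
  have hc := isCompact_of_isClosed_isBounded hemb.isClosed_range hb
  exact ⟨hemb.isInducing.isCompact_iff.2 (by simpa using hc)⟩

/-- The normalized Haar measure of `O(u)`. -/
def haarFixer (u : Sph d) : Measure (fixer u) := Measure.haarMeasure ⊤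

instance instIsProbabilityMeasureHaarFixer (u : Sph d) : IsProbabilityMeasure (haarFixer u) :=
  ⟨by simpa [haarFixer] using Measure.haarMeasure_self (G := fixer u) (K₀ := ⊤)⟩

/-- The rotational average `(S_u f)(x) = ∫_{O(u)} f (T x) dm(T)` of a function on the sphere. -/
def spinFun (u : Sph d) (f : Sph d → ℝ) (x : Sph d) : ℝ :=
  ∫ T : fixer u, f (rot (T : Orth d) x) ∂(haarFixer u)

lemma ne_zero_orth (T : Orth d) {x : Euc d} (hx : x ∈ ({0}ᶜ : Set (Euc d))) :
    (T : Euc d →L[ℝ] Euc d) x ∈ ({0}ᶜ : Set (Euc d)) := by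
  have h : x ≠ 0 := hx
  have : (T : Euc d →L[ℝ] Euc d) x ≠ 0 := by
    rw [← norm_ne_zero_iff, norm_orth]; exact norm_ne_zero_iff.2 h
  exact this

lemma homExt_rot (f : Sph d → ℝ) (T : Orth d) (x : Euc d) :
    homExt (fun y => f (rot T y)) x = homExt f ((T : Euc d →L[ℝ] Euc d) x) := by
  by_cases h : x = 0
  · simp [homExt, h]
  · have h' : (T : Euc d →L[ℝ] Euc d) x ≠ 0 := ne_zero_orth T h
    rw [homExt, homExt, dif_neg h, dif_neg h']
    congr 1
    apply Subtype.ext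
    simp [rot, norm_orth]

lemma homExt_spinFun (u : Sph d) (f : Sph d → ℝ) (x : Euc d) :
    homExt (spinFun u f) x
      = ∫ T : fixer u, homExt f (((T : Orth d) : Euc d →L[ℝ] Euc d) x) ∂(haarFixer u) := by
  by_cases h : x = 0
  · simp [homExt, h]
  · simp_rw [← homExt_rot]
    simp only [homExt, dif_neg h, spinFun]

/-- The `k`-th derivative of `x ↦ F (T x)`, for `F` the degree `0` extension of `f`. -/
def dAct (f : TestFun d) (k : ℕ) (T : Orth d) (x : Euc d) : Euc d [×k]→L[ℝ] ℝ :=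
  (iteratedFDeriv ℝ k (homExt f) ((T : Euc d →L[ℝ] Euc d) x)).compContinuousLinearMap
    fun _ => (T : Euc d →L[ℝ] Euc d)

lemma iteratedFDeriv_homExt_comp (f : TestFun d) (k : ℕ) (T : Orth d) (x : Euc d) :
    iteratedFDeriv ℝ k (fun y => homExt f ((T : Euc d →L[ℝ] Euc d) y)) x = dAct f k T x := by
  have := (Unitary.linearIsometryEquiv T).toContinuousLinearEquiv.iteratedFDerivWithin_comp_right
    (homExt f) uniqueDiffOn_univ (x := x) (Set.mem_univ _) k
  simp only [Set.preimage_univ, iteratedFDerivWithin_univ] at this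
  exact this

lemma norm_dAct (f : TestFun d) (k : ℕ) (T : Orth d) (x : Euc d) :
    ‖dAct f k T x‖ = ‖iteratedFDeriv ℝ k (homExt f) ((T : Euc d →L[ℝ] Euc d) x)‖ := by
  rw [← iteratedFDeriv_homExt_comp]
  exact (Unitary.linearIsometryEquiv T).norm_iteratedFDeriv_comp_right (homExt f) x k

lemma continuousOn_dAct (f : TestFun d) (k : ℕ) (u : Sph d) :
    ContinuousOn (fun p : fixer u × Euc d => dAct f k p.1 p.2) (Set.univ ×ˢ {0}ᶜ) := by
  have h0 : Continuous fun p : fixer u × Euc d => ((p.1 : Orth d) : Euc d →L[ℝ] Euc d) :=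
    continuous_subtype_val.comp (continuous_subtype_val.comp continuous_fst)
  have h1 : ContinuousOn (fun p : fixer u × Euc d => iteratedFDeriv ℝ k (homExt f)
      (((p.1 : Orth d) : Euc d →L[ℝ] Euc d) p.2)) (Set.univ ×ˢ {0}ᶜ) :=
    (continuousOn_iteratedFDeriv_homExt f k).comp (h0.clm_apply continuous_snd).continuousOn
      fun p hp => ne_zero_orth _ hp.2
  have h2 : Continuous fun p : fixer u × Euc d =>
      ContinuousMultilinearMap.compContinuousLinearMapContinuousMultilinear ℝ
        (fun _ : Fin k => Euc d) (fun _ : Fin k => Euc d) ℝ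
        (fun _ => ((p.1 : Orth d) : Euc d →L[ℝ] Euc d)) :=
    (ContinuousMultilinearMap.cont _).comp (continuous_pi fun _ => h0)
  exact h2.continuousOn.clm_apply h1

lemma continuous_dAct (f : TestFun d) (k : ℕ) (u : Sph d) {x : Euc d}
    (hx : x ∈ ({0}ᶜ : Set (Euc d))) : Continuous fun T : fixer u => dAct f k T x := by
  have := (continuousOn_dAct f k u).comp_continuous
    (f := fun T : fixer u => (T, x)) (by fun_prop) (fun T => ⟨trivial, hx⟩)
  exact this

lemma integrable_of_continuous {V : Type*} [NormedAddCommGroup V] (u : Sph d)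
    {g : fixer u → V} (hg : Continuous g) : Integrable g (haarFixer u) :=
  hg.integrable_of_hasCompactSupport (HasCompactSupport.of_compactSpace g)

lemma hasFDerivAt_dAct (f : TestFun d) (k : ℕ) (T : Orth d) {x : Euc d}
    (hx : x ∈ ({0}ᶜ : Set (Euc d))) :
    HasFDerivAt (dAct f k T) (dAct f (k + 1) T x).curryLeft x := by
  have hF : ContDiffAt ℝ ∞ (fun y => homExt f ((T : Euc d →L[ℝ] Euc d) y)) x :=
    ((contDiffOn_homExt f).contDiffAt (isOpen_compl_singleton.mem_nhds (ne_zero_orth T hx))).comp x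
      (T : Euc d →L[ℝ] Euc d).contDiff.contDiffAt
  have hd := (hF.differentiableAt_iteratedFDeriv (m := k)
    (mod_cast WithTop.coe_lt_top _)).hasFDerivAt
  have e : iteratedFDeriv ℝ k (fun y => homExt f ((T : Euc d →L[ℝ] Euc d) y)) = dAct f k T :=
    funext fun y => iteratedFDeriv_homExt_comp f k T y
  rw [e] at hd
  have hc : (dAct f (k + 1) T x).curryLeft = fderiv ℝ (dAct f k T) x := by
    rw [← e, ← iteratedFDeriv_homExt_comp]
    ext v m
    rw [ContinuousMultilinearMap.curryLeft_apply, iteratedFDeriv_succ_apply_left]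
    simp
  rw [hc]
  exact hd

lemma hasFDerivAt_integral_curry {G E : Type*} [TopologicalSpace G] [CompactSpace G]
    [MeasurableSpace G] [OpensMeasurableSpace G] [NormedAddCommGroup E] [NormedSpace ℝ E]
    [LocallyCompactSpace E] (μ : Measure G) [IsFiniteMeasure μ] {k : ℕ}
    {D : G → E → E [×k]→L[ℝ] ℝ} {D' : G → E → E [×(k + 1)]→L[ℝ] ℝ} {s : Set E} (hs : IsOpen s)
    (hD : ∀ y ∈ s, Continuous fun T => D T y)
    (hD' : ContinuousOn (fun p : G × E => D' p.1 p.2) (Set.univ ×ˢ s))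
    (hder : ∀ T, ∀ y ∈ s, HasFDerivAt (D T) (D' T y).curryLeft y) {x : E} (hx : x ∈ s) :
    HasFDerivAt (fun y => ∫ T, D T y ∂μ) (∫ T, D' T x ∂μ).curryLeft x := by
  have hint : ∀ {V : Type _} [NormedAddCommGroup V] {g : G → V}, Continuous g → Integrable g μ :=
    fun hg => hg.integrable_of_hasCompactSupport (HasCompactSupport.of_compactSpace _)
  obtain ⟨K, hK, hKx, hKs⟩ := exists_compact_subset hs hx
  obtain ⟨C, hC⟩ := ((isCompact_univ (X := G)).prod hK).exists_bound_of_continuousOn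
    (hD'.mono (Set.prod_mono subset_rfl hKs))
  have hDx : Continuous fun T => D' T x :=
    hD'.comp_continuous (f := fun T : G => (T, x)) (by fun_prop) (fun T => ⟨trivial, hx⟩)
  have hL : Continuous fun T => (D' T x).curryLeft :=
    (continuousMultilinearCurryLeftEquiv ℝ (fun _ : Fin (k + 1) => E) ℝ).continuous.comp hDx
  have h := hasFDerivAt_integral_of_dominated_of_fderiv_le (𝕜 := ℝ) (μ := μ)
    (F := fun y T => D T y) (F' := fun y T => (D' T y).curryLeft) (x₀ := x)
    (bound := fun _ => C) (mem_interior_iff_mem_nhds.1 hKx)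
    (by
      filter_upwards [hs.mem_nhds hx] with y hy
      exact (hint (hD y hy)).aestronglyMeasurable)
    (hint (hD x hx)) (hint hL).aestronglyMeasurable
    (Filter.Eventually.of_forall fun T y hy => by
      rw [ContinuousMultilinearMap.curryLeft_norm]
      exact hC (T, y) ⟨trivial, hy⟩)
    (integrable_const C)
    (Filter.Eventually.of_forall fun T y hy => hder T y (hKs hy))
  have hc : (∫ T, D' T x ∂μ).curryLeft = ∫ T, (D' T x).curryLeft ∂μ := by
    have hi := hint (V := E →L[ℝ] (E [×k]→L[ℝ] ℝ)) hL
    ext v m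
    rw [ContinuousMultilinearMap.curryLeft_apply, ContinuousMultilinearMap.integral_apply
      (hint hDx), ContinuousLinearMap.integral_apply hi,
      ContinuousMultilinearMap.integral_apply (hi.apply_continuousLinearMap v)]
    rfl
  rw [hc]
  exact h

/-- The derivatives of a rotational average are obtained by differentiating under the integral. -/
lemma hasFTaylorSeriesUpToOn_spin (u : Sph d) (f : TestFun d) :
    HasFTaylorSeriesUpToOn ∞ (homExt (spinFun u f))
      (fun x k => ∫ T : fixer u, dAct f k T x ∂(haarFixer u)) {0}ᶜ := by
  have key : ∀ (k : ℕ), ∀ x ∈ ({0}ᶜ : Set (Euc d)),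
      HasFDerivAt (fun x => ∫ T : fixer u, dAct f k T x ∂(haarFixer u))
        (∫ T : fixer u, dAct f (k + 1) T x ∂(haarFixer u)).curryLeft x := fun k x hx =>
    hasFDerivAt_integral_curry (haarFixer u) isOpen_compl_singleton
      (fun y hy => continuous_dAct f k u hy) (continuousOn_dAct f (k + 1) u)
      (fun T y hy => hasFDerivAt_dAct f k T hy) hx
  refine ⟨fun x hx => ?_, fun k _ x hx => (key k x hx).hasFDerivWithinAt,
    fun k _ x hx => (key k x hx).continuousAt.continuousWithinAt⟩
  rw [homExt_spinFun, ContinuousMultilinearMap.curry0,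
    ContinuousMultilinearMap.integral_apply (integrable_of_continuous u (continuous_dAct f 0 u hx))]
  simp [dAct]

/-- `S_u` maps test functions to test functions. -/
lemma contMDiff_spinFun (u : Sph d) (f : TestFun d) :
    ContMDiff (𝓡 d) 𝓘(ℝ, ℝ) ∞ (spinFun u f) := by
  have : Fact (Module.finrank ℝ (Euc d) = d + 1) := ⟨finrank_euclideanSpace_fin⟩
  have h : ContDiffOn ℝ ∞ (homExt (spinFun u f)) {0}ᶜ :=
    (hasFTaylorSeriesUpToOn_spin u f).contDiffOn
  have h1 : ContMDiff (𝓡 d) 𝓘(ℝ, ℝ) ∞ fun x : Sph d => homExt (spinFun u f) x := fun x =>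
    (h.contDiffAt (isOpen_compl_singleton.mem_nhds (sph_ne_zero x))).contMDiffAt.comp x
      (contMDiff_coe_sphere x)
  simpa only [homExt_coe] using h1

lemma continuous_rot (u x : Sph d) : Continuous fun T : fixer u => rot (T : Orth d) x :=
  Continuous.subtype_mk ((continuous_subtype_val.comp continuous_subtype_val).clm_apply
    continuous_const) _

/-- The rotational average `S_u` as a linear map on test functions. -/
def spinLin (u : Sph d) : TestFun d →ₗ[ℝ] TestFun d where
  toFun f := ⟨spinFun u f, contMDiff_spinFun u f⟩
  map_add' f g := by
    ext x
    exact integral_add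
      (integrable_of_continuous u (f.contMDiff.continuous.comp (continuous_rot u x)))
      (integrable_of_continuous u (g.contMDiff.continuous.comp (continuous_rot u x)))
  map_smul' c f := by
    ext x
    exact integral_const_mul c _

lemma testSeminorm_spinLin_le (u : Sph d) (k : ℕ) (f : TestFun d) :
    testSeminorm d k (spinLin u f) ≤ testSeminorm d k f := by
  have : Nonempty (Sph d) := ⟨u⟩
  refine ciSup_le fun x => ?_
  have h := (hasFTaylorSeriesUpToOn_spin u f).eq_iteratedFDerivWithin_of_uniqueDiffOn (m := k)
    (mod_cast le_top) isOpen_compl_singleton.uniqueDiffOn (sph_ne_zero x)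
  rw [iteratedFDerivWithin_of_isOpen k isOpen_compl_singleton (sph_ne_zero x)] at h
  change ‖iteratedFDeriv ℝ k (homExt (spinFun u f)) x‖ ≤ _
  rw [← h]
  have hb := norm_integral_le_of_norm_le_const (μ := haarFixer u)
    (f := fun T : fixer u => dAct f k T x) (C := testSeminorm d k f)
    (Filter.Eventually.of_forall fun T => by
      rw [norm_dAct]
      exact le_ciSup (bddAbove_iteratedFDeriv f k) (rot (T : Orth d) x))
  simpa using hb

/-- The rotational average `S_u` as a continuous linear map on test functions. -/
def spin (u : Sph d) : TestFun d →L[ℝ] TestFun d where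
  toLinearMap := spinLin u
  cont := by
    refine WithSeminorms.continuous_of_isBounded (testFun_withSeminorms d)
      (testFun_withSeminorms d) (spinLin u) fun k => ⟨{k}, 1, ?_⟩
    intro f
    simpa using testSeminorm_spinLin_le u k f

/-- The rotational average `S_u ρ` of a distribution, defined by duality:
`⟨S_u ρ, f⟩ = ⟨ρ, S_u f⟩`. -/
def spinDistribution (u : Sph d) (ρ : SphDistribution d) : SphDistribution d := ρ.comp (spin u)

end SphereSpin

end

noncomputable section

namespace SphereSpin

variable {d : ℕ}

/-! If `ρ` is positive, so is each `S_u ρ`, since `S_u` averages values of `f`. For the converse, a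
zonal function `x ↦ φ ⟪u, x⟫` is fixed by `S_u` (`spin_zonal`), so for `φ ≥ 0` positivity of `S_u ρ`
gives `0 ≤ ρ (zonal φ hφ u)`. It remains to approximate a nonnegative `f` by superpositions `c ∫
f(u) φ ⟪u, ·⟫ du` with `c ≥ 0`. Since `ρ` is bounded by finitely many derivatives
(`exists_abs_le_norm_jet`), the approximation is only needed in a Banach space of jets, where such
integrals lie in the closed convex cone generated by the allowed functions
(`smul_integral_jet_zonal_mem`).

The approximation is spherical convolution with a profile concentrated near `1`. To control
derivatives at `x`, a half-turn `R` carrying `x` to the direction of `y` and rotation invariance of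
the surface measure turn `∫ f(u) φ ⟪u, y/‖y‖⟫ du` into `∫ φ ⟪u, x⟫ f(R u) du`
(`integral_zonal_eq_turn`). All derivatives in `y` now fall on the smooth factor `f(R u)`. The
`k`-th derivative at `x`, once normalised, is a weighted mean of `turnDeriv f k x u` over `u` near
`x`. At `u = x` this is the derivative of `f` itself (`turnDeriv_self`), and uniform continuity on
the compact square of the sphere finishes the estimate. -/

/-! ### Partial derivatives of smooth functions and integrals depending on a parameter -/

section Parametric

variable {P E : Type*} [NormedAddCommGroup P] [NormedSpace ℝ P] [NormedAddCommGroup E]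
  [NormedSpace ℝ E]

/-- Iterated partial derivatives are restrictions of total derivatives. -/
lemma iteratedFDeriv_partial {Φ : P × E → ℝ} {Ω : Set (P × E)} (hΩ : IsOpen Ω)
    (hΦ : ContDiffOn ℝ ∞ Φ Ω) (k : ℕ) {q : P × E} (hq : q ∈ Ω) :
    iteratedFDeriv ℝ k (fun y => Φ (q.1, y)) q.2
      = (iteratedFDeriv ℝ k Φ q).compContinuousLinearMap
          fun _ => ContinuousLinearMap.inr ℝ P E := by
  -- The slice `y ↦ (q.1, y)` is the linear inclusion `inr` followed by translation by `a`, so the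
  -- chain rules for linear maps and translations suffice.
  set a : P × E := (q.1, 0) with ha
  have haq : a + ContinuousLinearMap.inr ℝ P E q.2 = q := by simp [ha]
  have ho : IsOpen ((fun z => a + z) ⁻¹' Ω) := hΩ.preimage (by fun_prop)
  have hc : ContDiffOn ℝ ∞ (fun z => Φ (a + z)) ((fun z => a + z) ⁻¹' Ω) :=
    hΦ.comp (by fun_prop) fun z hz => hz
  have ho' : IsOpen (ContinuousLinearMap.inr ℝ P E ⁻¹' ((fun z => a + z) ⁻¹' Ω)) :=
    ho.preimage (ContinuousLinearMap.inr ℝ P E).continuous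
  have hm : ContinuousLinearMap.inr ℝ P E q.2 ∈ (fun z => a + z) ⁻¹' Ω := by
    simpa only [Set.mem_preimage, haq] using hq
  have h := (ContinuousLinearMap.inr ℝ P E).iteratedFDerivWithin_comp_right hc ho.uniqueDiffOn
    ho'.uniqueDiffOn hm (i := k) (mod_cast le_top)
  rw [iteratedFDerivWithin_of_isOpen k ho' hm, iteratedFDerivWithin_of_isOpen k ho hm,
    iteratedFDeriv_comp_add_left, haq] at h
  rw [← h]
  congr 1
  ext y
  simp [ha]

lemma continuousOn_iteratedFDeriv_partial {Φ : P × E → ℝ} {Ω : Set (P × E)} (hΩ : IsOpen Ω)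
    (hΦ : ContDiffOn ℝ ∞ Φ Ω) (k : ℕ) :
    ContinuousOn (fun q : P × E => iteratedFDeriv ℝ k (fun y => Φ (q.1, y)) q.2) Ω := by
  have h := hΦ.continuousOn_iteratedFDerivWithin (m := k) (mod_cast le_top) hΩ.uniqueDiffOn
  have h' : ContinuousOn (iteratedFDeriv ℝ k Φ) Ω :=
    h.congr fun x hx => (iteratedFDerivWithin_of_isOpen k hΩ hx).symm
  exact ((ContinuousMultilinearMap.compContinuousLinearMapL
    fun _ : Fin k => ContinuousLinearMap.inr ℝ P E).continuous.comp_continuousOn h').congr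
    fun q hq => iteratedFDeriv_partial hΩ hΦ k hq

lemma contDiffAt_partial {Φ : P × E → ℝ} {Ω : Set (P × E)} (hΩ : IsOpen Ω)
    (hΦ : ContDiffOn ℝ ∞ Φ Ω) {p : P} {y : E} (hq : (p, y) ∈ Ω) :
    ContDiffAt ℝ ∞ (fun y => Φ (p, y)) y :=
  (hΦ.contDiffAt (hΩ.mem_nhds hq)).comp y (by fun_prop)

/-- Differentiation of all orders under a weighted integral over a compact parameter space. -/
lemma iteratedFDeriv_integral_smul {G : Type*} [TopologicalSpace G] [CompactSpace G]
    [MeasurableSpace G] [OpensMeasurableSpace G] [LocallyCompactSpace E]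
    (μ : Measure G) [IsFiniteMeasure μ] {Φ : P × E → ℝ} {Ω : Set (P × E)} (hΩ : IsOpen Ω)
    (hΦ : ContDiffOn ℝ ∞ Φ Ω) {p : G → P} (hp : Continuous p) {w : G → ℝ} (hw : Continuous w)
    {s : Set E} (hs : IsOpen s) (hsΩ : ∀ t, ∀ y ∈ s, (p t, y) ∈ Ω) (k : ℕ) {x : E} (hx : x ∈ s) :
    iteratedFDeriv ℝ k (fun y => ∫ t, w t * Φ (p t, y) ∂μ) x
      = ∫ t, w t • iteratedFDeriv ℝ k (fun y => Φ (p t, y)) x ∂μ := by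
  set D : (k : ℕ) → G → E → E [×k]→L[ℝ] ℝ :=
    fun k t y => w t • iteratedFDeriv ℝ k (fun y => Φ (p t, y)) y with hDdef
  have hcont : ∀ k, ContinuousOn (fun q : G × E => D k q.1 q.2) (Set.univ ×ˢ s) := fun k =>
    (hw.comp continuous_fst).continuousOn.smul
      ((continuousOn_iteratedFDeriv_partial hΩ hΦ k).comp
        (f := fun q : G × E => (p q.1, q.2)) (by fun_prop) fun q hq => hsΩ q.1 q.2 hq.2)
  have hslice : ∀ k, ∀ y ∈ s, Continuous fun t => D k t y := fun k y hy =>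
    (hcont k).comp_continuous (f := fun t : G => (t, y)) (by fun_prop) fun t => ⟨trivial, hy⟩
  have hder : ∀ k t, ∀ y ∈ s, HasFDerivAt (D k t) (D (k + 1) t y).curryLeft y := by
    intro k t y hy
    have hd := ((contDiffAt_partial hΩ hΦ (hsΩ t y hy)).differentiableAt_iteratedFDeriv (m := k)
      (mod_cast WithTop.coe_lt_top _)).hasFDerivAt.const_smul (w t)
    have hc : (D (k + 1) t y).curryLeft
        = w t • fderiv ℝ (iteratedFDeriv ℝ k fun y => Φ (p t, y)) y := by
      ext v m
      change w t • iteratedFDeriv ℝ (k + 1) (fun y => Φ (p t, y)) y (Fin.cons v m)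
        = w t • fderiv ℝ (iteratedFDeriv ℝ k fun y => Φ (p t, y)) y v m
      rw [iteratedFDeriv_succ_apply_left]
      simp
    rw [hc]
    exact hd
  have key : ∀ k, ∀ y ∈ s, HasFDerivAt (fun y => ∫ t, D k t y ∂μ)
      (∫ t, D (k + 1) t y ∂μ).curryLeft y := fun k y hy =>
    hasFDerivAt_integral_curry μ hs (hslice k) (hcont (k + 1)) (hder k) hy
  -- The integrals of `D k` form a Taylor series on the open set `s`; uniqueness of derivatives then
  -- identifies its terms.
  have hT : HasFTaylorSeriesUpToOn ∞ (fun y => ∫ t, w t * Φ (p t, y) ∂μ)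
      (fun y k => ∫ t, D k t y ∂μ) s := by
    refine ⟨fun y hy => ?_, fun k _ y hy => (key k y hy).hasFDerivWithinAt,
      fun k _ y hy => (key k y hy).continuousAt.continuousWithinAt⟩
    rw [ContinuousMultilinearMap.curry0, ContinuousMultilinearMap.integral_apply
      ((hslice 0 y hy).integrable_of_hasCompactSupport (HasCompactSupport.of_compactSpace _))]
    simp [hDdef]
  have h := hT.eq_iteratedFDerivWithin_of_uniqueDiffOn (m := k) (mod_cast le_top)
    hs.uniqueDiffOn hx
  rw [iteratedFDerivWithin_of_isOpen k hs hx] at h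
  exact h.symm

end Parametric

/-! ### Rotation invariance of the surface measure -/

/-- The surface measure of the unit sphere. -/
abbrev surf (d : ℕ) : Measure (Sph d) := (volume : Measure (Euc d)).toSphere

/-- The action of a linear isometry on the unit sphere. -/
def sphIso (e : Euc d ≃ₗᵢ[ℝ] Euc d) (x : Sph d) : Sph d :=
  ⟨e x, by rw [mem_sphere_zero_iff_norm, e.norm_map]; simp⟩

lemma continuous_sphIso (e : Euc d ≃ₗᵢ[ℝ] Euc d) : Continuous (sphIso e) :=
  (e.continuous.comp continuous_subtype_val).subtype_mk _

-- Up to a dimensional factor, `toSphere` measures a set by the volume of the cone over it; a linear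
-- isometry respects cones and volume.
open scoped Pointwise in
lemma measurePreserving_sphIso (e : Euc d ≃ₗᵢ[ℝ] Euc d) :
    MeasurePreserving (sphIso e) (surf d) (surf d) := by
  refine ⟨(continuous_sphIso e).measurable, ?_⟩
  ext s hs
  rw [Measure.map_apply (continuous_sphIso e).measurable hs, Measure.toSphere_apply' _ hs,
    Measure.toSphere_apply' _ ((continuous_sphIso e).measurable hs)]
  congr 1
  have : Set.Ioo (0 : ℝ) 1 • ((↑) '' (sphIso e ⁻¹' s) : Set (Euc d))
      = e ⁻¹' (Set.Ioo (0 : ℝ) 1 • ((↑) '' s)) := by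
    ext y
    simp only [Set.mem_smul, Set.mem_image, Set.mem_preimage]
    constructor
    · rintro ⟨r, hr, _, ⟨x, hx, rfl⟩, rfl⟩
      exact ⟨r, hr, e x, ⟨sphIso e x, hx, rfl⟩, by simp⟩
    · rintro ⟨r, hr, _, ⟨x, hx, rfl⟩, hy⟩
      refine ⟨r, hr, e.symm x, ⟨sphIso e.symm x, ?_, rfl⟩, ?_⟩
      · have : sphIso e (sphIso e.symm x) = x := Subtype.ext (by simp [sphIso])
        rwa [this]
      · apply e.injective
        simp [hy]
  rw [this]
  exact e.measurePreserving.measure_preimage_equiv (f := e.toMeasurableEquiv) _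

lemma integral_sphIso {V : Type*} [NormedAddCommGroup V] [NormedSpace ℝ V]
    (e : Euc d ≃ₗᵢ[ℝ] Euc d) (g : Sph d → V) :
    ∫ u, g (sphIso e u) ∂(surf d) = ∫ u, g u ∂(surf d) :=
  (measurePreserving_sphIso e).integral_comp
    ((continuous_sphIso e).isClosedEmbedding fun _ _ h =>
      Subtype.ext (e.injective (congrArg Subtype.val h))).measurableEmbedding g

/-! ### Zonal functions -/

/-- The zonal function `x ↦ φ ⟪u, x⟫` with axis `u`. -/
def zonal (φ : ℝ → ℝ) (hφ : ContDiff ℝ ∞ φ) (u : Sph d) : TestFun d :=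
  ⟨fun x => φ (inner ℝ (u : Euc d) x), by
    have : Fact (Module.finrank ℝ (Euc d) = d + 1) := ⟨finrank_euclideanSpace_fin⟩
    have h : ContDiff ℝ ∞ fun y : Euc d => φ (inner ℝ (u : Euc d) y) :=
      hφ.comp (contDiff_const.inner ℝ contDiff_id)
    exact h.contMDiff.comp contMDiff_coe_sphere⟩

lemma zonal_apply (φ : ℝ → ℝ) (hφ : ContDiff ℝ ∞ φ) (u x : Sph d) :
    zonal φ hφ u x = φ (inner ℝ (u : Euc d) x) := rfl

lemma inner_orth (T : Orth d) (x y : Euc d) :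
    inner ℝ ((T : Euc d →L[ℝ] Euc d) x) ((T : Euc d →L[ℝ] Euc d) y) = inner ℝ x y :=
  (Unitary.linearIsometryEquiv T).inner_map_map x y

/-- Zonal functions are invariant under averaging around their axis. -/
lemma spin_zonal (φ : ℝ → ℝ) (hφ : ContDiff ℝ ∞ φ) (u : Sph d) :
    spin u (zonal φ hφ u) = zonal φ hφ u := by
  ext x
  change ∫ T : fixer u, zonal φ hφ u (rot (T : Orth d) x) ∂(haarFixer u) = _
  have h : ∀ T : fixer u, zonal φ hφ u (rot (T : Orth d) x) = zonal φ hφ u x := by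
    intro T
    have hT : ((T : Orth d) : Euc d →L[ℝ] Euc d) u = u := T.2
    have := inner_orth (T : Orth d) u x
    rw [hT] at this
    simp only [zonal_apply, rot, this]
  simp [h]

lemma homExt_zonal (φ : ℝ → ℝ) (hφ : ContDiff ℝ ∞ φ) (u : Sph d) {y : Euc d} (hy : y ≠ 0) :
    homExt (zonal φ hφ u) y = φ (‖y‖⁻¹ * inner ℝ (u : Euc d) y) := by
  rw [homExt, dif_neg hy, zonal_apply, inner_smul_right]

/-- The degree `0` extension of a zonal function, as a function of the axis and the point. -/
def zonalKernel (φ : ℝ → ℝ) (q : Euc d × Euc d) : ℝ := φ (‖q.2‖⁻¹ * inner ℝ q.1 q.2)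

lemma isOpen_snd_ne_zero : IsOpen {q : Euc d × Euc d | q.2 ≠ 0} :=
  isOpen_ne_fun continuous_snd continuous_const

lemma contDiffOn_zonalKernel {φ : ℝ → ℝ} (hφ : ContDiff ℝ ∞ φ) :
    ContDiffOn ℝ ∞ (zonalKernel (d := d) φ) {q | q.2 ≠ 0} := by
  intro q hq
  have hn : ContDiffAt ℝ ∞ (fun q : Euc d × Euc d => ‖q.2‖⁻¹) q :=
    (contDiffAt_snd.norm ℝ hq).inv (norm_ne_zero_iff.2 hq)
  exact (hφ.contDiffAt.comp q
    (hn.mul (contDiffAt_fst.inner ℝ contDiffAt_snd))).contDiffWithinAt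

lemma homExt_zonal_eventuallyEq (φ : ℝ → ℝ) (hφ : ContDiff ℝ ∞ φ) (u x : Sph d) :
    homExt (zonal φ hφ u) =ᶠ[nhds (x : Euc d)] fun y => zonalKernel φ ((u : Euc d), y) := by
  filter_upwards [isOpen_compl_singleton.mem_nhds (sph_ne_zero x)] with y hy
  exact homExt_zonal φ hφ u hy

/-- Joint continuity in axis and point is what makes `u ↦ jet s (zonal φ hφ u)` continuous for the
sup norm, hence Bochner integrable. -/
lemma continuous_iteratedFDeriv_homExt_zonal (φ : ℝ → ℝ) (hφ : ContDiff ℝ ∞ φ) (k : ℕ) :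
    Continuous fun q : Sph d × Sph d => iteratedFDeriv ℝ k (homExt (zonal φ hφ q.1)) q.2 := by
  have h := (continuousOn_iteratedFDeriv_partial isOpen_snd_ne_zero
    (contDiffOn_zonalKernel (d := d) hφ) k).comp_continuous
    (f := fun q : Sph d × Sph d => ((q.1 : Euc d), (q.2 : Euc d))) (by fun_prop)
    fun q => sph_ne_zero q.2
  refine h.congr fun q => ?_
  exact ((homExt_zonal_eventuallyEq φ hφ q.1 q.2).iteratedFDeriv ℝ k).self_of_nhds.symm

/-! ### Jets of test functions -/

/-- The Banach space of families of continuous tensor fields on the sphere, one of each order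
`k ∈ s`. -/
def JetSpace (d : ℕ) (s : Finset ℕ) : Type := (k : s) → C(Sph d, Euc d [×(k : ℕ)]→L[ℝ] ℝ)

instance instNormedAddCommGroupJetSpace (s : Finset ℕ) : NormedAddCommGroup (JetSpace d s) :=
  inferInstanceAs (NormedAddCommGroup ((k : s) → C(Sph d, Euc d [×(k : ℕ)]→L[ℝ] ℝ)))

instance instNormedSpaceJetSpace (s : Finset ℕ) : NormedSpace ℝ (JetSpace d s) :=
  inferInstanceAs (NormedSpace ℝ ((k : s) → C(Sph d, Euc d [×(k : ℕ)]→L[ℝ] ℝ)))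

instance instCompleteSpaceJetSpace (s : Finset ℕ) : CompleteSpace (JetSpace d s) :=
  inferInstanceAs (CompleteSpace ((k : s) → C(Sph d, Euc d [×(k : ℕ)]→L[ℝ] ℝ)))

lemma continuous_jetSpace_iff {X : Type*} [TopologicalSpace X] {s : Finset ℕ}
    {g : X → JetSpace d s} :
    Continuous g ↔ ∀ k : s, Continuous fun x => (g x k : C(Sph d, Euc d [×(k : ℕ)]→L[ℝ] ℝ)) :=
  continuous_pi_iff (A := fun k : s => C(Sph d, Euc d [×(k : ℕ)]→L[ℝ] ℝ)) (f := g)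

/-- The derivatives of orders `k ∈ s` of a test function. -/
def jet (s : Finset ℕ) : TestFun d →ₗ[ℝ] JetSpace d s where
  toFun f k := ⟨fun x => iteratedFDeriv ℝ k (homExt f) x,
    (continuousOn_iteratedFDeriv_homExt f k).comp_continuous continuous_subtype_val sph_ne_zero⟩
  map_add' f g := by
    refine funext fun k => ContinuousMap.ext fun x => ?_
    change iteratedFDeriv ℝ k (homExt (f + g : TestFun d)) x
          = iteratedFDeriv ℝ k (homExt f) x + iteratedFDeriv ℝ k (homExt g) x
    rw [ContMDiffMap.coe_add, homExt_add]
    exact iteratedFDeriv_add_apply (contDiffAt_homExt f x k) (contDiffAt_homExt g x k)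
  map_smul' c f := by
    refine funext fun k => ContinuousMap.ext fun x => ?_
    change iteratedFDeriv ℝ k (homExt (c • f : TestFun d)) x
          = c • iteratedFDeriv ℝ k (homExt f) x
    rw [ContMDiffMap.coe_smul, homExt_smul,
        iteratedFDeriv_const_smul_apply (contDiffAt_homExt f x k)]

lemma testSeminorm_le_norm_jet (s : Finset ℕ) (f : TestFun d) {k : ℕ} (hk : k ∈ s) :
    testSeminorm d k f ≤ ‖jet s f‖ := by
  have : Nonempty (Sph d) := (NormedSpace.sphere_nonempty.2 zero_le_one).to_subtype
  exact ciSup_le fun x => ((jet s f ⟨k, hk⟩).norm_coe_le_norm x).trans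
    (norm_le_pi_norm (jet s f) ⟨k, hk⟩)

/-- A distribution is controlled by finitely many derivatives. -/
lemma exists_abs_le_norm_jet (ρ : SphDistribution d) :
    ∃ (s : Finset ℕ) (C : ℝ), 0 ≤ C ∧ ∀ f, |ρ f| ≤ C * ‖jet s f‖ := by
  obtain ⟨s, C, -, h⟩ := Seminorm.bound_of_continuous (testFun_withSeminorms d)
    ((normSeminorm ℝ ℝ).comp ρ.toLinearMap) (by
      change Continuous fun f => ‖ρ f‖
      exact ρ.continuous.norm)
  refine ⟨s, C, C.2, fun f => (h f).trans ?_⟩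
  change C * s.sup (testSeminorm d) f ≤ _
  gcongr
  exact Seminorm.finset_sup_apply_le (norm_nonneg _) fun k hk => testSeminorm_le_norm_jet s f hk

/-- The bound makes `ρ` continuous for the jet norm, so nonnegativity survives limits of jets. -/
lemma nonneg_of_jet_mem_closure {ρ : SphDistribution d} {s : Finset ℕ} {C : ℝ} (hC : 0 ≤ C)
    (hρ : ∀ f, |ρ f| ≤ C * ‖jet s f‖) {f : TestFun d}
    (hf : jet s f ∈ closure (jet s '' {g | 0 ≤ ρ g})) : 0 ≤ ρ f := by
  refine le_of_forall_pos_le_add fun ε hε => ?_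
  -- The denominator is `C + 1` because `C` may vanish.
  obtain ⟨_, ⟨g, hg, rfl⟩, hd⟩ := Metric.mem_closure_iff.1 hf (ε / (C + 1)) (by positivity)
  have h := hρ (g - f)
  rw [map_sub, map_sub, ← dist_eq_norm, dist_comm] at h
  have h1 : C * dist (jet s f) (jet s g) ≤ ε := by
    calc C * dist (jet s f) (jet s g) ≤ (C + 1) * (ε / (C + 1)) := by
          gcongr
          linarith
      _ = ε := by field_simp
  have h2 : 0 ≤ ρ g := hg
  linarith [le_abs_self (ρ g - ρ f)]

lemma continuous_jet_zonal (φ : ℝ → ℝ) (hφ : ContDiff ℝ ∞ φ) (s : Finset ℕ) :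
    Continuous fun u : Sph d => jet s (zonal φ hφ u) := by
  refine continuous_jetSpace_iff.2 fun k => ?_
  refine ContinuousMap.continuous_of_continuous_uncurry _ ?_
  exact continuous_iteratedFDeriv_homExt_zonal φ hφ k

/-- Nonnegative multiples of integrals of functions with values in a closed convex cone belong to
the cone. -/
lemma smul_integral_mem_of_cone {X B : Type*} [MeasurableSpace X] (μ : Measure X)
    [IsFiniteMeasure μ] [NeZero μ] [NormedAddCommGroup B] [NormedSpace ℝ B] [CompleteSpace B]
    {K : Set B} (hK : Convex ℝ K) (hKc : IsClosed K) {g : X → B} (hg : Integrable g μ)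
    (hmem : ∀ a : ℝ, 0 ≤ a → ∀ x, a • g x ∈ K) {c : ℝ} (hc : 0 ≤ c) : c • ∫ x, g x ∂μ ∈ K := by
  -- Convexity handles averages only; the total mass is absorbed by scaling the integrand, which
  -- stays in `K`.
  have h := hK.average_mem hKc
    (Filter.Eventually.of_forall (hmem (c * μ.real Set.univ) (by positivity))) (hg.smul _)
  rw [average_eq, integral_smul, smul_smul] at h
  have h0 : μ.real Set.univ ≠ 0 := measureReal_univ_ne_zero
  rwa [show (μ.real Set.univ)⁻¹ * (c * μ.real Set.univ) = c by field_simp] at h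

lemma integrable_smul_jet_zonal {φ : ℝ → ℝ} (hφ : ContDiff ℝ ∞ φ) (f : TestFun d)
    (s : Finset ℕ) : Integrable (fun u => f u • jet s (zonal φ hφ u)) (surf d) :=
  Continuous.integrable_of_hasCompactSupport
    (Continuous.smul f.contMDiff.continuous (continuous_jet_zonal φ hφ s))
    (HasCompactSupport.of_compactSpace _)

instance instNeZeroSurf : NeZero (surf d) := ⟨Measure.toSphere_ne_zero _⟩

/-- A superposition of zonal functions with nonnegative weight belongs to the closed cone spanned
by the functions on which the distribution is nonnegative. -/
lemma smul_integral_jet_zonal_mem {ρ : SphDistribution d}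
    (hρ : ∀ u, IsPositive (spinDistribution u ρ)) {φ : ℝ → ℝ} (hφ : ContDiff ℝ ∞ φ)
    (hφ0 : ∀ t, 0 ≤ φ t) {f : TestFun d} (hf : ∀ x, 0 ≤ f x) (s : Finset ℕ) {c : ℝ}
    (hc : 0 ≤ c) :
    c • ∫ u, f u • jet s (zonal φ hφ u) ∂(surf d) ∈ closure (jet s '' {g | 0 ≤ ρ g}) := by
  have hconv : Convex ℝ (jet s '' {g | 0 ≤ ρ g}) :=
    (convex_halfSpace_ge ρ.toLinearMap.isLinear 0).linear_image _
  refine smul_integral_mem_of_cone (surf d) hconv.closure isClosed_closure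
    (integrable_smul_jet_zonal hφ f s) (fun a ha u => ?_) hc
  refine subset_closure ⟨a • f u • zonal φ hφ u, ?_, by rw [map_smul, map_smul]⟩
  -- The hypothesis on `S_u ρ` enters only here, with `u` the axis of the zonal function.
  have hz : 0 ≤ ρ (zonal φ hφ u) := by
    have h : 0 ≤ ρ (spin u (zonal φ hφ u)) := hρ u (zonal φ hφ u) fun x => hφ0 _
    rwa [spin_zonal] at h
  rw [Set.mem_ofPred_eq, map_smul, map_smul]
  exact mul_nonneg ha (mul_nonneg (hf u) hz)

/-! ### Half-turns exchanging two directions -/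

/-- The half-turn about the bisector of the directions of `x` and `y`, for a unit vector `x`. -/
def halfTurn (x y : Euc d) : Euc d ≃ₗᵢ[ℝ] Euc d := (ℝ ∙ (‖y‖ • x + y)).reflection

/-- This explicit formula exhibits smoothness in all three of `x`, `y`, `u`. -/
lemma halfTurn_apply (x y u : Euc d) :
    halfTurn x y u = (2 * (inner ℝ (‖y‖ • x + y) u * (‖‖y‖ • x + y‖ ^ 2)⁻¹)) • (‖y‖ • x + y) - u := by
  rw [halfTurn, Submodule.reflection_singleton_apply, two_smul, ← add_smul, ← two_mul]
  rfl

lemma bisector_ne_zero {x y : Euc d} (hxy : 0 < inner ℝ x y) : ‖y‖ • x + y ≠ 0 := by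
  intro h
  have h1 : inner ℝ x (‖y‖ • x + y) = 0 := by rw [h, inner_zero_right]
  rw [inner_add_right, inner_smul_right] at h1
  have h2 : 0 ≤ ‖y‖ * inner ℝ x x := mul_nonneg (norm_nonneg _) real_inner_self_nonneg
  linarith

/-- The vectors `‖y‖ • x` and `y` have equal length, so reflection in the line of their sum
exchanges them. -/
lemma halfTurn_self {x y : Euc d} (hx : ‖x‖ = 1) (hxy : 0 < inner ℝ x y) :
    halfTurn x y x = ‖y‖⁻¹ • y := by
  have hy : y ≠ 0 := by rintro rfl; simp at hxy
  have hn : 0 < ‖y‖ := norm_pos_iff.2 hy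
  have h1 : inner ℝ (‖y‖ • x + y) x = ‖y‖ + inner ℝ x y := by
    rw [inner_add_left, inner_smul_left, real_inner_self_eq_norm_sq, hx, real_inner_comm x y]
    simp
  have h2 : ‖‖y‖ • x + y‖ ^ 2 = 2 * ‖y‖ * (‖y‖ + inner ℝ x y) := by
    rw [norm_add_sq_real, norm_smul, inner_smul_left, hx]
    simp
    ring
  have h3 : 2 * ((‖y‖ + inner ℝ x y) * (2 * ‖y‖ * (‖y‖ + inner ℝ x y))⁻¹) = ‖y‖⁻¹ := by
    have : ‖y‖ + inner ℝ x y ≠ 0 := by positivity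
    field_simp
  rw [halfTurn_apply, h1, h2, h3, smul_add, smul_smul, inv_mul_cancel₀ hn.ne', one_smul]
  abel

/-- The function `((x, u), y) ↦ f (R u)`, where `R` is the half-turn about the bisector of `x`
and `y`. -/
def turnKernel (f : TestFun d) (q : (Euc d × Euc d) × Euc d) : ℝ :=
  homExt f (halfTurn q.1.1 q.2 q.1.2)

/-- The domain of smoothness of `turnKernel`. -/
def turnDomain (d : ℕ) : Set ((Euc d × Euc d) × Euc d) :=
  {q | q.1.2 ≠ 0 ∧ q.2 ≠ 0 ∧ ‖q.2‖ • q.1.1 + q.2 ≠ 0}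

lemma isOpen_turnDomain : IsOpen (turnDomain d) :=
  (isOpen_ne_fun (by fun_prop) continuous_const).inter
    ((isOpen_ne_fun (by fun_prop) continuous_const).inter
      (isOpen_ne_fun (by fun_prop) continuous_const))

lemma contDiffOn_turnKernel (f : TestFun d) : ContDiffOn ℝ ∞ (turnKernel f) (turnDomain d) := by
  rintro q ⟨h1, h2, h3⟩
  have hw : ContDiffAt ℝ ∞ (fun q : (Euc d × Euc d) × Euc d => ‖q.2‖ • q.1.1 + q.2) q :=
    ((contDiffAt_snd.norm ℝ h2).smul (by fun_prop)).add contDiffAt_snd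
  have ht : ContDiffAt ℝ ∞
      (fun q : (Euc d × Euc d) × Euc d => halfTurn q.1.1 q.2 q.1.2) q := by
    simp only [halfTurn_apply]
    exact (((contDiffAt_const.mul ((hw.inner ℝ (by fun_prop)).mul
      ((hw.norm_sq ℝ).inv (by simpa using h3)))).smul hw).sub (by fun_prop))
  have hne : halfTurn q.1.1 q.2 q.1.2 ∈ ({0}ᶜ : Set (Euc d)) := by simpa using h1
  exact (((contDiffOn_homExt f).contDiffAt (isOpen_compl_singleton.mem_nhds hne)).comp q
    ht).contDiffWithinAt

lemma mem_turnDomain {x y : Euc d} (hxy : 0 < inner ℝ x y) (u : Sph d) :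
    ((x, (u : Euc d)), y) ∈ turnDomain d :=
  ⟨sph_ne_zero u, by rintro rfl; simp at hxy, bisector_ne_zero hxy⟩

lemma inner_self_sph (x : Sph d) : inner ℝ (x : Euc d) x = (1 : ℝ) := by
  rw [real_inner_self_eq_norm_sq]; simp

/-- The `k`-th derivative at `x` of `f` along the half-turns moving `x`, evaluated near `u`. -/
def turnDeriv (f : TestFun d) (k : ℕ) (x u : Sph d) : Euc d [×k]→L[ℝ] ℝ :=
  iteratedFDeriv ℝ k (fun y => turnKernel f (((x : Euc d), (u : Euc d)), y)) x

/-- The point `x` is both a parameter of the kernel and the point of differentiation, so continuity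
of partial derivatives in all variables jointly is needed. -/
lemma continuous_turnDeriv (f : TestFun d) (k : ℕ) :
    Continuous fun q : Sph d × Sph d => turnDeriv f k q.1 q.2 :=
  (continuousOn_iteratedFDeriv_partial isOpen_turnDomain (contDiffOn_turnKernel f)
    k).comp_continuous
    (f := fun q : Sph d × Sph d => (((q.1 : Euc d), (q.2 : Euc d)), (q.1 : Euc d)))
    (by fun_prop) fun q => mem_turnDomain (by rw [inner_self_sph]; exact one_pos) q.2

lemma homExt_inv_norm_smul (f : Sph d → ℝ) {y : Euc d} (hy : y ≠ 0) :
    homExt f (‖y‖⁻¹ • y) = homExt f y := by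
  have h := homExt_coe f ⟨‖y‖⁻¹ • y, by simp [norm_smul, hy]⟩
  rw [h, homExt, dif_neg hy]

lemma isOpen_inner_pos (x : Euc d) : IsOpen {y : Euc d | 0 < inner ℝ x y} :=
  isOpen_lt continuous_const (by fun_prop)

/-- For `u = x` the half-turn sends `u` to `‖y‖⁻¹ • y`, where the degree `0` extension takes the
same value as at `y`. -/
lemma turnDeriv_self (f : TestFun d) (k : ℕ) (x : Sph d) :
    turnDeriv f k x x = iteratedFDeriv ℝ k (homExt f) x := by
  have h : (fun y => turnKernel f (((x : Euc d), (x : Euc d)), y))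
      =ᶠ[nhds (x : Euc d)] homExt f := by
    filter_upwards [(isOpen_inner_pos (x : Euc d)).mem_nhds
      (by simp)] with y hy
    rw [turnKernel, halfTurn_self (by simp) hy, homExt_inv_norm_smul]
    rintro rfl
    simp at hy
  exact (h.iteratedFDeriv ℝ k).self_of_nhds

/-! ### Spherical convolution with a zonal function -/

/-- Substituting `u ↦ halfTurn x y u` moves the dependence on `y` from the profile to `f`. The
derivatives of the profile, relative to its mass, would be uncontrolled as caps shrink. -/
lemma integral_zonal_eq_turn (φ : ℝ → ℝ) (f : TestFun d) (x : Sph d) {y : Euc d}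
    (hxy : 0 < inner ℝ (x : Euc d) y) :
    ∫ u, f u * zonalKernel φ ((u : Euc d), y) ∂(surf d)
      = ∫ u, φ (inner ℝ (u : Euc d) x)
          * turnKernel f (((x : Euc d), (u : Euc d)), y) ∂(surf d) := by
  rw [← integral_sphIso (halfTurn x y)]
  refine integral_congr_ae (Filter.Eventually.of_forall fun u => ?_)
  have h1 : inner ℝ (halfTurn x y u) (‖y‖⁻¹ • y) = inner ℝ (u : Euc d) x := by
    rw [← halfTurn_self (by simp) hxy, LinearIsometryEquiv.inner_map_map]
  rw [inner_smul_right] at h1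
  have h2 : turnKernel f (((x : Euc d), (u : Euc d)), y) = f (sphIso (halfTurn x y) u) :=
    homExt_coe f (sphIso (halfTurn x y) u)
  change f (sphIso (halfTurn x y) u) * φ (‖y‖⁻¹ * inner ℝ (halfTurn x y u) y) = _
  rw [h1, ← h2, mul_comm]

/-- The derivatives of a superposition of zonal functions, in terms of those of the weight. -/
lemma integral_iteratedFDeriv_zonal (φ : ℝ → ℝ) (hφ : ContDiff ℝ ∞ φ) (f : TestFun d) (k : ℕ)
    (x : Sph d) :
    ∫ u, f u • iteratedFDeriv ℝ k (homExt (zonal φ hφ u)) x ∂(surf d)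
      = ∫ u, φ (inner ℝ (u : Euc d) x) • turnDeriv f k x u ∂(surf d) := by
  have hx : (x : Euc d) ∈ {y : Euc d | 0 < inner ℝ (x : Euc d) y} := by simp
  have h1 := iteratedFDeriv_integral_smul (surf d) isOpen_snd_ne_zero
    (contDiffOn_zonalKernel (d := d) hφ) (p := fun u : Sph d => (u : Euc d))
    continuous_subtype_val f.contMDiff.continuous (s := {0}ᶜ) isOpen_compl_singleton
    (fun t y hy => hy) k (sph_ne_zero x)
  have h2 := iteratedFDeriv_integral_smul (surf d) isOpen_turnDomain
    (contDiffOn_turnKernel f) (p := fun u : Sph d => ((x : Euc d), (u : Euc d)))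
    (by fun_prop) (w := fun u : Sph d => φ (inner ℝ (u : Euc d) x))
    (hφ.continuous.comp (by fun_prop)) (isOpen_inner_pos (x : Euc d))
    (fun t y hy => mem_turnDomain hy t) k hx
  -- The two representations agree on a whole neighbourhood of `x`, hence so do their derivatives
  -- there.
  have h3 : (fun y => ∫ u, f u * zonalKernel φ ((u : Euc d), y) ∂(surf d))
      =ᶠ[nhds (x : Euc d)] fun y => ∫ u, φ (inner ℝ (u : Euc d) x)
          * turnKernel f (((x : Euc d), (u : Euc d)), y) ∂(surf d) := by
    filter_upwards [(isOpen_inner_pos (x : Euc d)).mem_nhds hx] with y hy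
    exact integral_zonal_eq_turn φ f x hy
  rw [(h3.iteratedFDeriv ℝ k).self_of_nhds, h2] at h1
  refine Eq.trans (integral_congr_ae (Filter.Eventually.of_forall fun u => ?_)) h1.symm
  change f u • _ = f u • _
  rw [((homExt_zonal_eventuallyEq φ hφ u x).iteratedFDeriv ℝ k).self_of_nhds]

lemma exists_isometry_map (x y : Sph d) : ∃ e : Euc d ≃ₗᵢ[ℝ] Euc d, e x = y :=
  ⟨_, Submodule.reflection_sub (v := (x : Euc d)) (w := y) (by simp)⟩

/-- The total mass of a zonal kernel does not depend on its axis. -/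
lemma integral_inner_eq (φ : ℝ → ℝ) (x y : Sph d) :
    ∫ u, φ (inner ℝ (u : Euc d) x) ∂(surf d) = ∫ u, φ (inner ℝ (u : Euc d) y) ∂(surf d) := by
  obtain ⟨e, he⟩ := exists_isometry_map x y
  rw [← integral_sphIso e (fun u => φ (inner ℝ (u : Euc d) y))]
  refine integral_congr_ae (Filter.Eventually.of_forall fun u => ?_)
  change _ = φ (inner ℝ (e u) (y : Euc d))
  rw [← he, LinearIsometryEquiv.inner_map_map]

/-! ### Approximation by superpositions of zonal functions -/

/-- Evaluation of the order `k` component of a jet at a point. -/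
def jetEval (s : Finset ℕ) (k : s) (x : Sph d) :
    JetSpace d s →L[ℝ] (Euc d [×(k : ℕ)]→L[ℝ] ℝ) :=
  LinearMap.mkContinuous
    { toFun := fun g => (g k : C(Sph d, Euc d [×(k : ℕ)]→L[ℝ] ℝ)) x
      map_add' := fun _ _ => rfl
      map_smul' := fun _ _ => rfl } 1 fun g => by
    rw [one_mul]
    exact ((g k : C(Sph d, Euc d [×(k : ℕ)]→L[ℝ] ℝ)).norm_coe_le_norm x).trans
      (norm_le_pi_norm (ι := s) (G := fun k : s => C(Sph d, Euc d [×(k : ℕ)]→L[ℝ] ℝ)) g k)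

lemma jetEval_jet (s : Finset ℕ) (k : s) (x : Sph d) (f : TestFun d) :
    jetEval s k x (jet s f) = iteratedFDeriv ℝ k (homExt f) x := rfl

lemma norm_jetSpace_le {s : Finset ℕ} {g : JetSpace d s} {ε : ℝ} (hε : 0 ≤ ε)
    (h : ∀ k x, ‖jetEval s k x g‖ ≤ ε) : ‖g‖ ≤ ε :=
  (pi_norm_le_iff_of_nonneg (ι := s) (G := fun k : s => C(Sph d, Euc d [×(k : ℕ)]→L[ℝ] ℝ))
    (x := g) hε).2 fun k => (ContinuousMap.norm_le _ hε).2 (h k)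

lemma jetEval_integral_zonal {φ : ℝ → ℝ} (hφ : ContDiff ℝ ∞ φ) (f : TestFun d)
    (s : Finset ℕ) (k : s) (x : Sph d) :
    jetEval s k x (∫ u, f u • jet s (zonal φ hφ u) ∂(surf d))
      = ∫ u, φ (inner ℝ (u : Euc d) x) • turnDeriv f k x u ∂(surf d) := by
  rw [← ContinuousLinearMap.integral_comp_comm _ (integrable_smul_jet_zonal hφ f s),
    ← integral_iteratedFDeriv_zonal φ hφ f k x]
  simp only [map_smul, jetEval_jet]

/-- The weighted mean of a function which is `ε`-close to `a` where the weight is nonzero. -/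
lemma norm_sub_inv_smul_integral_le {X V : Type*} [MeasurableSpace X] {μ : Measure X}
    [NormedAddCommGroup V] [NormedSpace ℝ V] [CompleteSpace V] {w : X → ℝ} {g : X → V} {a : V}
    {ε : ℝ} (hw : Integrable w μ) (hw0 : ∀ u, 0 ≤ w u) (hpos : 0 < ∫ u, w u ∂μ)
    (hg : Integrable (fun u => w u • g u) μ) (h : ∀ u, w u ≠ 0 → ‖a - g u‖ ≤ ε) :
    ‖a - (∫ u, w u ∂μ)⁻¹ • ∫ u, w u • g u ∂μ‖ ≤ ε := by
  have h1 : a - (∫ u, w u ∂μ)⁻¹ • ∫ u, w u • g u ∂μ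
      = (∫ u, w u ∂μ)⁻¹ • ∫ u, w u • (a - g u) ∂μ := by
    simp only [smul_sub]
    rw [integral_sub (hw.smul_const a) hg, integral_smul_const, smul_sub, smul_smul,
      inv_mul_cancel₀ hpos.ne', one_smul]
  have h2 : ‖∫ u, w u • (a - g u) ∂μ‖ ≤ ∫ u, w u * ε ∂μ := by
    refine norm_integral_le_of_norm_le (hw.mul_const ε) (Filter.Eventually.of_forall fun u => ?_)
    rw [norm_smul, Real.norm_of_nonneg (hw0 u)]
    by_cases hu : w u = 0
    · simp [hu]
    · exact mul_le_mul_of_nonneg_left (h u hu) (hw0 u)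
  rw [integral_mul_const] at h2
  rw [h1, norm_smul, norm_inv, Real.norm_of_nonneg hpos.le, inv_mul_le_iff₀ hpos]
  exact h2

/-- A smooth nonnegative function supported in `[1 - δ ^ 2 / 2, ∞)`. -/
def capProfile (δ t : ℝ) : ℝ := Real.smoothTransition (t - (1 - δ ^ 2 / 2))

lemma contDiff_capProfile (δ : ℝ) : ContDiff ℝ ∞ (capProfile δ) :=
  Real.smoothTransition.contDiff.comp (contDiff_id.sub contDiff_const)

lemma capProfile_nonneg (δ t : ℝ) : 0 ≤ capProfile δ t := Real.smoothTransition.nonneg _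

/-- For unit vectors `‖u - x‖ ^ 2 = 2 - 2 ⟪u, x⟫`, which explains the threshold `1 - δ ^ 2 / 2`. -/
lemma dist_lt_of_capProfile_ne_zero {δ : ℝ} (hδ : 0 < δ) {u x : Sph d}
    (h : capProfile δ (inner ℝ (u : Euc d) x) ≠ 0) : dist u x < δ := by
  have h1 : 0 < inner ℝ (u : Euc d) x - (1 - δ ^ 2 / 2) := by
    by_contra hn
    exact h (Real.smoothTransition.zero_of_nonpos (not_lt.1 hn))
  have h2 := norm_sub_sq_real (u : Euc d) x
  rw [Subtype.dist_eq, dist_eq_norm]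
  simp only [norm_eq_of_mem_sphere] at h2
  exact lt_of_pow_lt_pow_left₀ 2 hδ.le (by linarith)

lemma continuous_capProfile_inner (δ : ℝ) (x : Sph d) :
    Continuous fun u : Sph d => capProfile δ (inner ℝ (u : Euc d) x) :=
  (contDiff_capProfile δ).continuous.comp (by fun_prop)

lemma integral_capProfile_pos {δ : ℝ} (hδ : 0 < δ) (x : Sph d) :
    0 < ∫ u, capProfile δ (inner ℝ (u : Euc d) x) ∂(surf d) := by
  refine (continuous_capProfile_inner δ x).integral_pos_of_hasCompactSupport_nonneg_nonzero
    (HasCompactSupport.of_compactSpace _) (fun u => capProfile_nonneg δ _) (x := x) ?_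
  rw [inner_self_sph]
  exact (Real.smoothTransition.pos_of_pos (by ring_nf; positivity)).ne'

/-- Uniform continuity on the compact product compares `(x, u)` with the diagonal point `(x, x)`;
finitely many orders share one `δ`. -/
lemma exists_turnDeriv_sub_le (f : TestFun d) (s : Finset ℕ) {ε : ℝ} (hε : 0 < ε) :
    ∃ δ > 0, ∀ (k : s) (x u : Sph d), dist u x < δ →
      ‖iteratedFDeriv ℝ k (homExt f) x - turnDeriv f k x u‖ ≤ ε := by
  have h : ∀ k : s, ∀ᶠ δ in nhdsWithin (0 : ℝ) (Set.Ioi 0), ∀ x u : Sph d, dist u x < δ →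
      ‖iteratedFDeriv ℝ k (homExt f) x - turnDeriv f k x u‖ ≤ ε := by
    intro k
    have huc := CompactSpace.uniformContinuous_of_continuous (continuous_turnDeriv f k)
    obtain ⟨δ, hδ, H⟩ := Metric.uniformContinuous_iff.1 huc ε hε
    filter_upwards [Ioo_mem_nhdsGT hδ] with r hr x u hux
    have := H (a := (x, x)) (b := (x, u)) (by
      rw [dist_prod_same_left, dist_comm]
      exact hux.trans hr.2)
    rw [dist_eq_norm] at this
    simpa only [turnDeriv_self] using this.le
  obtain ⟨δ, h1, h2⟩ := ((Filter.eventually_all.2 h).and self_mem_nhdsWithin).exists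
  exact ⟨δ, h2, h1⟩

lemma norm_sub_mean_turnDeriv_le (f : TestFun d) (k : ℕ) (x : Sph d) {δ ε : ℝ} (hδ : 0 < δ)
    (h : ∀ u : Sph d, dist u x < δ →
      ‖iteratedFDeriv ℝ k (homExt f) x - turnDeriv f k x u‖ ≤ ε) :
    ‖iteratedFDeriv ℝ k (homExt f) x - (∫ u, capProfile δ (inner ℝ (u : Euc d) x) ∂(surf d))⁻¹ •
      ∫ u, capProfile δ (inner ℝ (u : Euc d) x) • turnDeriv f k x u ∂(surf d)‖ ≤ ε := by
  have hc := continuous_capProfile_inner δ x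
  have ht : Continuous fun u => turnDeriv f k x u :=
    Continuous.comp (g := fun q : Sph d × Sph d => turnDeriv f k q.1 q.2)
      (f := fun u : Sph d => (x, u)) (continuous_turnDeriv f k) (by fun_prop)
  have hi : Integrable (fun u : Sph d => capProfile δ (inner ℝ (u : Euc d) x)) (surf d) :=
    hc.integrable_of_hasCompactSupport (HasCompactSupport.of_compactSpace _)
  have hi' : Integrable
      (fun u : Sph d => capProfile δ (inner ℝ (u : Euc d) x) • turnDeriv f k x u) (surf d) :=
    Continuous.integrable_of_hasCompactSupport (Continuous.smul hc ht)
      (HasCompactSupport.of_compactSpace _)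
  exact norm_sub_inv_smul_integral_le hi (fun u => capProfile_nonneg δ _)
    (integral_capProfile_pos hδ x) hi' fun u hu => h u (dist_lt_of_capProfile_ne_zero hδ hu)

lemma exists_norm_jet_sub_le (f : TestFun d) (s : Finset ℕ) {ε : ℝ} (hε : 0 < ε) :
    ∃ (δ c : ℝ), 0 ≤ c ∧
      ‖jet s f - c • ∫ u, f u • jet s (zonal (capProfile δ) (contDiff_capProfile δ) u)
        ∂(surf d)‖ ≤ ε := by
  obtain ⟨δ, hδ, h⟩ := exists_turnDeriv_sub_le f s hε
  obtain ⟨e⟩ : Nonempty (Sph d) := (NormedSpace.sphere_nonempty.2 zero_le_one).to_subtype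
  refine ⟨δ, (∫ u, capProfile δ (inner ℝ (u : Euc d) e) ∂(surf d))⁻¹,
    inv_nonneg.2 (integral_capProfile_pos hδ e).le, norm_jetSpace_le hε.le fun k x => ?_⟩
  -- The mass of the profile is independent of its axis, so the constant computed at `e` normalises
  -- the mean at every `x`.
  rw [map_sub, map_smul, jetEval_integral_zonal, jetEval_jet, integral_inner_eq _ e x]
  exact norm_sub_mean_turnDeriv_le f k x hδ (h k x)

/-! ### Positivity of a distribution from its rotational averages -/

lemma isPositive_of_spinDistribution {ρ : SphDistribution d}
    (hρ : ∀ u, IsPositive (spinDistribution u ρ)) : IsPositive ρ := by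
  intro f hf
  obtain ⟨s, C, hC, hbound⟩ := exists_abs_le_norm_jet ρ
  refine nonneg_of_jet_mem_closure hC hbound ?_
  -- The approximating integrals are themselves only known to lie in the closure of the cone.
  rw [← closure_closure]
  refine Metric.mem_closure_iff.2 fun ε hε => ?_
  obtain ⟨δ, c, hc, h⟩ := exists_norm_jet_sub_le f s (half_pos hε)
  refine ⟨_, smul_integral_jet_zonal_mem hρ (contDiff_capProfile δ) (capProfile_nonneg δ) hf s hc,
    ?_⟩
  rw [dist_eq_norm]
  exact h.trans_lt (half_lt_self hε)

lemma IsPositive.spinDistribution {ρ : SphDistribution d} (hρ : IsPositive ρ) (u : Sph d) :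
    IsPositive (spinDistribution u ρ) := fun _ hf =>
  hρ _ fun _ => integral_nonneg fun _ => hf _

end SphereSpin

end

theorem mainTheorem2 (d : ℕ) (ρ : SphereSpin.SphDistribution d) :
    SphereSpin.IsPositive ρ ↔
      ∀ u : SphereSpin.Sph d, SphereSpin.IsPositive (SphereSpin.spinDistribution u ρ) :=
  ⟨fun h => h.spinDistribution, SphereSpin.isPositive_of_spinDistribution⟩
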